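/- Proposition (Quantum query complexity of Connectivity). For $n \ge 2$, let $\mathrm{Conn}_n : \{0,1\}^{\binom n2} \to \{0,1\}$ be the function whose input $x = (x_{\{i,j\}})_{\{i,j\}}$ is the adjacency matrix of an undirected simple graph on $n$ vertices ($x_{\{i,j\}} = 1$ iff $\{i,j\}$ is an edge) and whose value is $1$ if this graph is connected and $0$ otherwise. A quantum query algorithm with $T$ queries for inputs $x \in \{0,1\}^I$ ($I$ a finite index set) consists of a memory dimension $d \ge 1$, an initial basis state $|i_0,0\rangle|w_0\rangle$ and input-independent unitary operators $U_0,\dots,U_T$ on the space spanned by the basis vectors $|i,b\rangle|w\rangle$ with $i \in I$, $b \in \{0,1\}$, $w \in \{1,\dots,d\}$. Its final state on input $x$ is $U_T O_x U_{T-1} O_x \cdots U_1 O_x U_0 |i_0,0\rangle|w_0\rangle$, where $O_x |i,b\rangle|w\rangle = |i,b\oplus x_i\rangle|w\rangle$, and its output is the result of measuring the register $b$ of the final state in the standard basis. The algorithm computes $f : \{0,1\}^I \to \{0,1\}$ if on every input $x$ it outputs $f(x)$ with probability at least $2/3$. The quantum query complexity $Q(f)$ is the smallest $T$ for which such an algorithm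 with $T$ queries computes $f$. Then there exists a quantum query algorithm for $\mathrm{Conn}_n$ with query complexity $Q(\mathrm{Conn}_n) = O(n^{3/2})$. That is, there is a universal constant $C$ such that, for every $n \ge 2$, $Q(\mathrm{Conn}_n)$ is attained by some quantum query algorithm computing $\mathrm{Conn}_n$, and $Q(\mathrm{Conn}_n) \le C\, n^{3/2}$. -/

import Mathlib

/-- The Hilbert space spanned by the basis vectors `|i, b⟩ ⊗ |w⟩`, where `i : ι` is the index
register, `b : Bool` the value register and `w : Fin d` an additional memory register. -/
abbrev QueryState (ι : Type*) (d : ℕ) : Type _ :=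
  EuclideanSpace ℂ (ι × Bool × Fin d)

/-- The action of the binary oracle on basis labels: `(i, b, w) ↦ (i, b ⊕ x i, w)`. -/
def oraclePerm {ι : Type*} (x : ι → Bool) (d : ℕ) : Equiv.Perm (ι × Bool × Fin d) :=
  Function.Involutive.toPerm (fun s => (s.1, xor s.2.1 (x s.1), s.2.2))
    (fun s => by simp)

/-- The binary oracle `O_x`, i.e. the unitary operator with
`O_x (|i, b⟩ ⊗ |w⟩) = |i, b ⊕ x i⟩ ⊗ |w⟩`. -/
noncomputable def queryOracle {ι : Type*} [Fintype ι] (x : ι → Bool) (d : ℕ) :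
    QueryState ι d ≃ₗᵢ[ℂ] QueryState ι d :=
  LinearIsometryEquiv.piLpCongrLeft 2 ℂ ℂ (oraclePerm x d)

/-- The defining equation of the oracle on basis vectors. -/
theorem queryOracle_single {ι : Type*} [Fintype ι] [DecidableEq ι] (x : ι → Bool) (d : ℕ)
    (i : ι) (b : Bool) (w : Fin d) :
    queryOracle x d (EuclideanSpace.single (i, b, w) (1 : ℂ)) =
      EuclideanSpace.single (i, xor b (x i), w) (1 : ℂ) := by
  unfold queryOracle
  exact EuclideanSpace.piLpCongrLeft_single (oraclePerm x d) (i, b, w) 1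

/-- A quantum query algorithm with `T` queries on inputs `x : ι → Bool`: a finite memory dimension,
a basis state `|i₀, 0⟩ ⊗ |w₀⟩` in which the algorithm starts, and unitary operators
`U_0, …, U_T` which do not depend on the input. -/
structure QuantumQueryAlgorithm (ι : Type*) [Fintype ι] (T : ℕ) where
  /-- dimension of the memory register -/
  memDim : ℕ
  /-- initial content of the index register -/
  startIndex : ι
  /-- initial content of the memory register -/
  startMem : Fin memDim
  /-- the input-independent unitaries -/
  U : Fin (T + 1) → (QueryState ι memDim ≃ₗᵢ[ℂ] QueryState ι memDim)

namespace QuantumQueryAlgorithm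

open Classical in
/-- The intermediate state `U_t O_x U_{t-1} O_x ⋯ U_1 O_x U_0 |i₀, 0⟩|w₀⟩` after `t` queries. -/
noncomputable def state {ι : Type*} [Fintype ι] {T : ℕ} (A : QuantumQueryAlgorithm ι T)
    (x : ι → Bool) (t : Fin (T + 1)) : QueryState ι A.memDim :=
  Fin.induction (motive := fun _ => QueryState ι A.memDim)
    (A.U 0 (EuclideanSpace.single (A.startIndex, false, A.startMem) (1 : ℂ)))
    (fun s ψ => A.U s.succ (queryOracle x A.memDim ψ)) t

/-- The probability that measuring the value register of the final state in the standard basis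
gives `b`, i.e. the squared norm of the projection of the final state on the span of the
`|i, b⟩ ⊗ |w⟩`. -/
noncomputable def outputProb {ι : Type*} [Fintype ι] {T : ℕ} (A : QuantumQueryAlgorithm ι T)
    (x : ι → Bool) (b : Bool) : ℝ :=
  ∑ i : ι, ∑ w : Fin A.memDim, ‖A.state x (Fin.last T) (i, b, w)‖ ^ 2

/-- The algorithm computes `f` (with bounded error) if on every input it outputs the correct
value with probability at least `2/3`. -/
def Computes {ι : Type*} [Fintype ι] {T : ℕ} (A : QuantumQueryAlgorithm ι T)
    (f : (ι → Bool) → Bool) : Prop :=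
  ∀ x : ι → Bool, 2 / 3 ≤ A.outputProb x (f x)

end QuantumQueryAlgorithm

/-- The quantum query complexity `Q(f)`: the smallest `T` such that some quantum query algorithm
with `T` queries computes `f`. -/
noncomputable def quantumQueryComplexity {ι : Type*} [Fintype ι] (f : (ι → Bool) → Bool) : ℕ :=
  sInf {T : ℕ | ∃ A : QuantumQueryAlgorithm ι T, A.Computes f}

/-- The query indices for graphs on `n` vertices: the unordered pairs `{i, j}` with `i ≠ j`. -/
abbrev VertexPair (n : ℕ) : Type := {e : Sym2 (Fin n) // ¬ e.IsDiag}

/-- The graph represented by `x`: the vertices `i` and `j` are adjacent iff `x_{i,j} = 1`. -/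
def inputGraph {n : ℕ} (x : VertexPair n → Bool) : SimpleGraph (Fin n) where
  Adj i j := ∃ h : ¬ (s(i, j)).IsDiag, x ⟨s(i, j), h⟩ = true
  symm := ⟨fun i j h => by rw [Sym2.eq_swap]; exact h⟩
  loopless := ⟨fun i h => h.1 (by simp)⟩

open Classical in
/-- The Connectivity function: `1` iff the graph represented by the input is connected. -/
noncomputable def connectivity (n : ℕ) (x : VertexPair n → Bool) : Bool :=
  decide (inputGraph x).Connected

/-! The algorithm is a span program for `n` simultaneous flows, from a root `s` to every vertex `u`.
Let `K` be the space of tuples of potential differences, with an extra target coordinate, `R` the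
phase oracle, `ψ` the target vector and `u` the composite of `R` with the reflection in `K`. If the
graph is disconnected, potentials constant on both sides of a cut give a fixed vector of `u` near
`ψ` (`exists_cut_witness`), so the mean of the first `N` orbit points of `ψ` has norm near 1. If it
is connected, unit flows make `ψ` a coboundary of `u` (`exists_flow_witness`), so the mean is at
most a constant over `N`. A controlled walk measures the norm of this mean (`exists_outputProb_eq`).

The cost `n ^ (3 / 2)` comes from using all `u` at once. A cut isolating `m` vertices has at most `n
* m` pairs, but the unit target amplitude is shared among `m` potentials, so the error does not
depend on `m`. -/

/-! ### Query algorithms on relabelled registers -/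

/-- A unitary operator taking a given basis vector to a given unit vector. -/
theorem exists_unitary_single_eq {S : Type*} [Fintype S] [DecidableEq S] (s : S)
    (v : EuclideanSpace ℂ S) (hv : ‖v‖ = 1) :
    ∃ G : EuclideanSpace ℂ S ≃ₗᵢ[ℂ] EuclideanSpace ℂ S, G (EuclideanSpace.single s 1) = v := by
  have ho : Orthonormal ℂ (({s} : Set S).domRestrict fun _ => v) := by
    refine ⟨fun _ => hv, fun i j hij => absurd (Subsingleton.elim i j) hij⟩
  obtain ⟨b, hb⟩ := ho.exists_orthonormalBasis_extension_of_card_eq (by simp)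
  refine ⟨b.repr.symm, ?_⟩
  rw [OrthonormalBasis.repr_symm_single]
  exact hb s rfl

/-- The oracle on a space whose basis is labelled by `S` through `e : S ≃ ι × Bool × Fin d`. -/
def relabelledOracle {ι S : Type*} {d : ℕ} (e : S ≃ ι × Bool × Fin d) (x : ι → Bool)
    (Ψ : EuclideanSpace ℂ S) : EuclideanSpace ℂ S :=
  WithLp.toLp 2 fun s => Ψ (e.symm (oraclePerm x d (e s)))

/-- The state after `k` queries, starting from `Ψ₀`, with unitary `U k` after query number `k`. -/
noncomputable def relabelledState {ι S : Type*} [Fintype S] {d : ℕ} (e : S ≃ ι × Bool × Fin d)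
    (x : ι → Bool) (U : ℕ → (EuclideanSpace ℂ S ≃ₗᵢ[ℂ] EuclideanSpace ℂ S))
    (Ψ₀ : EuclideanSpace ℂ S) : ℕ → EuclideanSpace ℂ S
  | 0 => Ψ₀
  | k + 1 => U k (relabelledOracle e x (relabelledState e x U Ψ₀ k))

namespace QuantumQueryAlgorithm

variable {ι : Type*} [Fintype ι] {T : ℕ}

open Classical in
theorem state_zero (A : QuantumQueryAlgorithm ι T) (x : ι → Bool) :
    A.state x 0 = A.U 0 (EuclideanSpace.single (A.startIndex, false, A.startMem) (1 : ℂ)) :=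
  rfl

theorem state_succ (A : QuantumQueryAlgorithm ι T) (x : ι → Bool) (t : Fin T) :
    A.state x t.succ = A.U t.succ (queryOracle x A.memDim (A.state x t.castSucc)) :=
  rfl

theorem norm_state (A : QuantumQueryAlgorithm ι T) (x : ι → Bool) (t : Fin (T + 1)) :
    ‖A.state x t‖ = 1 := by
  classical
  induction t using Fin.induction with
  | zero => rw [state_zero]; simp
  | succ t ih => rw [state_succ]; simp [ih]

/-- Lets a small probability of `false` certify the answer `true`. -/
theorem outputProb_add (A : QuantumQueryAlgorithm ι T) (x : ι → Bool) :
    A.outputProb x true + A.outputProb x false = 1 := by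
  have h := congrArg (· ^ 2) (A.norm_state x (Fin.last T))
  simp only [EuclideanSpace.norm_sq_eq, Fintype.sum_prod_type, Fintype.sum_bool, one_pow] at h
  rw [← h, outputProb, outputProb, ← Finset.sum_add_distrib]

/-- An algorithm described on a relabelled space, with a unit vector as initial state and an
additional final unitary. -/
theorem exists_of_relabelled {S : Type*} [Fintype S] {d : ℕ} (e : S ≃ ι × Bool × Fin d)
    (s₀ : S) (hs₀ : (e s₀).2.1 = false)
    (U : ℕ → (EuclideanSpace ℂ S ≃ₗᵢ[ℂ] EuclideanSpace ℂ S))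
    (Ψ₀ : EuclideanSpace ℂ S) (hΨ₀ : ‖Ψ₀‖ = 1)
    (V : EuclideanSpace ℂ S ≃ₗᵢ[ℂ] EuclideanSpace ℂ S) (T : ℕ) :
    ∃ A : QuantumQueryAlgorithm ι T, ∀ x, ∀ b,
      A.outputProb x b = ∑ s with (e s).2.1 = b, ‖V (relabelledState e x U Ψ₀ T) s‖ ^ 2 := by
  classical
  obtain ⟨G, hG⟩ := exists_unitary_single_eq s₀ Ψ₀ hΨ₀
  let c := LinearIsometryEquiv.piLpCongrLeft 2 ℂ ℂ e
  have hc : ∀ Ψ y, c Ψ y = Ψ (e.symm y) := fun Ψ y => rfl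
  -- `W 0` prepares `Ψ₀` and `F` merges `V` into the last unitary, so neither costs a query.
  let W : ℕ → (EuclideanSpace ℂ S ≃ₗᵢ[ℂ] EuclideanSpace ℂ S) := fun k => Nat.casesOn k G U
  let F : ℕ → (EuclideanSpace ℂ S ≃ₗᵢ[ℂ] EuclideanSpace ℂ S) := fun k =>
    if k = T then V else LinearIsometryEquiv.refl ℂ _
  let A : QuantumQueryAlgorithm ι T :=
    { memDim := d
      startIndex := (e s₀).1
      startMem := (e s₀).2.2
      U := fun k => c.symm.trans (((W k).trans (F k)).trans c) }
  have hstate : ∀ x (t : Fin (T + 1)), A.state x t = c (F t (relabelledState e x U Ψ₀ t)) := by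
    intro x t
    induction t using Fin.induction with
    | zero =>
      rw [state_zero]
      have h1 : c.symm (EuclideanSpace.single (A.startIndex, false, A.startMem) (1 : ℂ)) =
          EuclideanSpace.single s₀ 1 := by
        rw [LinearIsometryEquiv.symm_apply_eq]
        have : (A.startIndex, false, A.startMem) = e s₀ := by
          rw [← hs₀]
        rw [this]
        exact (EuclideanSpace.piLpCongrLeft_single e s₀ 1).symm
      change c (F 0 (G (c.symm _))) = _
      rw [h1, hG]
      rfl
    | succ t ih =>
      rw [state_succ, ih]
      have hF : F (t.castSucc : Fin (T + 1)) = LinearIsometryEquiv.refl ℂ _ :=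
        if_neg (by simpa using t.2.ne)
      rw [hF]
      have h2 : ∀ Ψ, c.symm (queryOracle x d (c Ψ)) = relabelledOracle e x Ψ := by
        intro Ψ
        rw [LinearIsometryEquiv.symm_apply_eq]
        ext y
        simp only [hc, relabelledOracle, Equiv.apply_symm_apply]
        rfl
      change c (F (t + 1) (U t (c.symm (queryOracle x d (c _))))) = _
      rw [h2]
      rfl
  refine ⟨A, fun x b => ?_⟩
  have hF : F T = V := if_pos rfl
  rw [outputProb, hstate]
  simp only [Fin.val_last, hF, hc]
  rw [Finset.sum_filter, ← e.symm.sum_comp, Fintype.sum_prod_type]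
  refine Finset.sum_congr rfl fun i _ => ?_
  rw [Fintype.sum_prod_type]
  simp only [Equiv.apply_symm_apply]
  rw [Finset.sum_comm]
  refine Finset.sum_congr rfl fun w _ => ?_
  simp

end QuantumQueryAlgorithm

/-! ### Unitary building blocks -/

/-- The block diagonal operator with blocks `V k`. -/
noncomputable def blockDiagonalUnitary {κ J : Type*} [Fintype κ] [Fintype J]
    (V : κ → (EuclideanSpace ℂ J ≃ₗᵢ[ℂ] EuclideanSpace ℂ J)) :
    EuclideanSpace ℂ (κ × J) ≃ₗᵢ[ℂ] EuclideanSpace ℂ (κ × J) where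
  toFun Ψ := WithLp.toLp 2 fun s => V s.1 (WithLp.toLp 2 fun j => Ψ (s.1, j)) s.2
  invFun Ψ := WithLp.toLp 2 fun s => (V s.1).symm (WithLp.toLp 2 fun j => Ψ (s.1, j)) s.2
  left_inv Ψ := by ext ⟨k, j⟩; simp
  right_inv Ψ := by ext ⟨k, j⟩; simp
  map_add' Ψ Φ := by
    ext ⟨k, j⟩
    exact congrArg (· j) ((V k).map_add (WithLp.toLp 2 fun j => Ψ (k, j))
      (WithLp.toLp 2 fun j => Φ (k, j)))
  map_smul' a Ψ := by
    ext ⟨k, j⟩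
    exact congrArg (· j) ((V k).map_smul a (WithLp.toLp 2 fun j => Ψ (k, j)))
  norm_map' Ψ := by
    rw [← sq_eq_sq₀ (norm_nonneg _) (norm_nonneg _), EuclideanSpace.norm_sq_eq,
      EuclideanSpace.norm_sq_eq, Fintype.sum_prod_type, Fintype.sum_prod_type]
    refine Finset.sum_congr rfl fun k _ => ?_
    have h := congrArg (· ^ 2) ((V k).norm_map (WithLp.toLp 2 fun j => Ψ (k, j)))
    simp only [EuclideanSpace.norm_sq_eq] at h
    exact h

theorem blockDiagonalUnitary_apply {κ J : Type*} [Fintype κ] [Fintype J]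
    (V : κ → (EuclideanSpace ℂ J ≃ₗᵢ[ℂ] EuclideanSpace ℂ J)) (Ψ : EuclideanSpace ℂ (κ × J))
    (k : κ) (j : J) :
    blockDiagonalUnitary V Ψ (k, j) = V k (WithLp.toLp 2 fun j => Ψ (k, j)) j :=
  rfl

/-- The diagonal operator with entries `-1` where `p` holds and `1` elsewhere. -/
noncomputable def signUnitary {J : Type*} [Fintype J] (p : J → Bool) :
    EuclideanSpace ℂ J ≃ₗᵢ[ℂ] EuclideanSpace ℂ J where
  toFun Ψ := WithLp.toLp 2 fun j => (if p j then -1 else 1) * Ψ j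
  invFun Ψ := WithLp.toLp 2 fun j => (if p j then -1 else 1) * Ψ j
  left_inv Ψ := by ext j; by_cases h : p j <;> simp [h]
  right_inv Ψ := by ext j; by_cases h : p j <;> simp [h]
  map_add' Ψ Φ := by ext j; simp [mul_add]
  map_smul' a Ψ := by ext j; simp [mul_left_comm]
  norm_map' Ψ := by
    rw [← sq_eq_sq₀ (norm_nonneg _) (norm_nonneg _), EuclideanSpace.norm_sq_eq,
      EuclideanSpace.norm_sq_eq]
    refine Finset.sum_congr rfl fun j _ => ?_
    by_cases h : p j <;> simp [h]

theorem signUnitary_apply {J : Type*} [Fintype J] (p : J → Bool) (Ψ : EuclideanSpace ℂ J) (j : J) :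
    signUnitary p Ψ j = (if p j then -1 else 1) * Ψ j :=
  rfl

theorem signUnitary_signUnitary {J : Type*} [Fintype J] (p : J → Bool) (Ψ : EuclideanSpace ℂ J) :
    signUnitary p (signUnitary p Ψ) = Ψ :=
  (signUnitary p).symm_apply_apply Ψ

/-- A unitary on a control register and an output bit which, on output bit `false`, leaves the
uniform superposition unchanged and flips the output bit on its orthogonal complement. -/
theorem exists_uniform_test (N : ℕ) (hN : 0 < N) :
    ∃ G : EuclideanSpace ℂ (Fin N × Bool) ≃ₗᵢ[ℂ] EuclideanSpace ℂ (Fin N × Bool),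
      ∀ Ψ : EuclideanSpace ℂ (Fin N × Bool), (∀ t, Ψ (t, true) = 0) →
        ∀ t, G Ψ (t, false) = (N : ℂ)⁻¹ * ∑ t', Ψ (t', false) := by
  -- The map `1 - 2P`, with `P` the projection on `v`, swaps the uniform states with bits `false`
  -- and `true` and fixes the complement of `v`. The bit flip `X` then undoes the swap on the
  -- uniform part and flips the bit on the rest.
  let v : EuclideanSpace ℂ (Fin N × Bool) := WithLp.toLp 2 fun s => if s.2 then 1 else -1
  have hv : ‖v‖ ^ 2 = 2 * N := by
    rw [EuclideanSpace.norm_sq_eq, Fintype.sum_prod_type]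
    simp [v]
    ring
  let X := LinearIsometryEquiv.piLpCongrLeft 2 ℂ ℂ
    ((Equiv.refl (Fin N)).prodCongr Equiv.boolNot)
  refine ⟨((Submodule.reflection (ℂ ∙ v)).trans (LinearIsometryEquiv.neg ℂ)).trans X, ?_⟩
  intro Ψ hΨ t
  change -(Submodule.reflection (ℂ ∙ v) Ψ) (t, true) = _
  have hN' : (N : ℂ) ≠ 0 := by exact_mod_cast hN.ne'
  have hv' : ((‖v‖ : ℂ)) ^ 2 = 2 * N := by exact_mod_cast congrArg (fun r : ℝ => (r : ℂ)) hv
  have hin : inner ℂ v Ψ = -∑ t', Ψ (t', false) := by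
    rw [PiLp.inner_apply, Fintype.sum_prod_type]
    simp [v, hΨ]
  rw [Submodule.reflection_singleton_apply]
  simp [hΨ, hv', hin, v]
  field_simp

/-! ### Orbit sums of an isometry -/

section ErgodicMean

variable {E : Type*} [NormedAddCommGroup E] [InnerProductSpace ℂ E]

theorem sum_iterate_of_fixed (u : E →ₗᵢ[ℂ] E) {φ : E} (h : u φ = φ) (N : ℕ) :
    ∑ t ∈ Finset.range N, u^[t] φ = N • φ := by
  simp [Function.iterate_fixed h]

theorem norm_iterate (u : E →ₗᵢ[ℂ] E) (v : E) (t : ℕ) : ‖u^[t] v‖ = ‖v‖ := by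
  induction t with
  | zero => rfl
  | succ t ih => rw [Function.iterate_succ_apply', u.norm_map, ih]

theorem iterate_sub (u : E →ₗᵢ[ℂ] E) (v w : E) (t : ℕ) :
    u^[t] (v - w) = u^[t] v - u^[t] w := by
  induction t with
  | zero => rfl
  | succ t ih => simp only [Function.iterate_succ_apply', ih, map_sub]

/-- Near a fixed vector the orbit sum grows linearly. -/
theorem le_norm_sum_iterate (u : E →ₗᵢ[ℂ] E) {φ ψ : E} (h : u φ = φ) (N : ℕ) :
    N * (‖ψ‖ - 2 * ‖φ - ψ‖) ≤ ‖∑ t ∈ Finset.range N, u^[t] ψ‖ := by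
  have h1 : ∑ t ∈ Finset.range N, u^[t] ψ =
      N • φ - ∑ t ∈ Finset.range N, u^[t] (φ - ψ) := by
    simp only [iterate_sub, Finset.sum_sub_distrib, sum_iterate_of_fixed u h, sub_sub_cancel]
  have h2 : ‖∑ t ∈ Finset.range N, u^[t] (φ - ψ)‖ ≤ N * ‖φ - ψ‖ := by
    refine (norm_sum_le _ _).trans ?_
    simp only [norm_iterate, Finset.sum_const, Finset.card_range, nsmul_eq_mul, le_refl]
  have h3 : ‖ψ‖ ≤ ‖φ‖ + ‖φ - ψ‖ := by
    have := norm_sub_le φ (φ - ψ)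
    rwa [sub_sub_cancel] at this
  have h4 : ‖N • φ‖ = N * ‖φ‖ := by
    rw [← Nat.cast_smul_eq_nsmul ℝ, norm_smul]
    simp
  rw [h1]
  have h5 := norm_sub_norm_le (N • φ) (∑ t ∈ Finset.range N, u^[t] (φ - ψ))
  rw [h4] at h5
  have h6 := mul_le_mul_of_nonneg_left h3 (Nat.cast_nonneg (α := ℝ) N)
  linarith

/-- The orbit sum of a coboundary stays bounded. -/
theorem norm_sum_iterate_le (u : E →ₗᵢ[ℂ] E) {v ψ : E} (h : ψ = v - u v) (N : ℕ) :
    ‖∑ t ∈ Finset.range N, u^[t] ψ‖ ≤ 2 * ‖v‖ := by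
  have h1 : ∑ t ∈ Finset.range N, u^[t] ψ = v - u^[N] v := by
    simp only [h, iterate_sub, ← Function.iterate_succ_apply]
    exact Finset.sum_range_sub' (fun t => u^[t] v) N
  rw [h1]
  refine (norm_sub_le _ _).trans ?_
  rw [norm_iterate]
  linarith

end ErgodicMean

variable {ι W : Type*} [Fintype ι] [Fintype W]

/-! ### The controlled walk -/

/-- The phase oracle, which acts trivially if the memory register contains `none`. -/
noncomputable def phaseOracle (x : ι → Bool) :
    EuclideanSpace ℂ (ι × Option W) ≃ₗᵢ[ℂ] EuclideanSpace ℂ (ι × Option W) :=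
  signUnitary fun s => x s.1 && s.2.isSome

namespace WalkAlgorithm

variable {N : ℕ}

/-- Labels: a control register and the output bit, then the index and memory registers. -/
abbrev Label (N : ℕ) (ι W : Type*) := (Fin N × Bool) × (ι × Option W)

/-- The placement of the registers in a query algorithm. -/
noncomputable def placement (N : ℕ) (ι W : Type*) [Fintype W] :
    Label N ι W ≃ ι × Bool × Fin (Fintype.card (Fin N × Option W)) where
  toFun s := (s.2.1, s.1.2, Fintype.equivFin _ (s.1.1, s.2.2))
  invFun y := ((((Fintype.equivFin _).symm y.2.2).1, y.2.1),
    (y.1, ((Fintype.equivFin _).symm y.2.2).2))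
  left_inv s := by simp
  right_inv y := by simp

theorem relabelledOracle_placement {ι W : Type*} [Fintype W] (x : ι → Bool)
    (Ψ : EuclideanSpace ℂ (Label N ι W))
    (t : Fin N) (b : Bool) (i : ι) (w : Option W) :
    relabelledOracle (placement N ι W) x Ψ ((t, b), (i, w)) = Ψ ((t, xor b (x i)), (i, w)) := by
  have h : (placement N ι W).symm
      (oraclePerm x _ (placement N ι W ((t, b), (i, w)))) = ((t, xor b (x i)), (i, w)) := by
    rw [Equiv.symm_apply_eq]
    rfl
  exact congrArg Ψ h

/-- The superposition of branches `χ t` with output bit `false`. -/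
noncomputable def branches (χ : Fin N → EuclideanSpace ℂ (ι × Option W)) :
    EuclideanSpace ℂ (Label N ι W) :=
  WithLp.toLp 2 fun s => if s.1.2 then 0 else χ s.1.1 s.2

theorem norm_sq_branches (χ : Fin N → EuclideanSpace ℂ (ι × Option W)) :
    ‖branches χ‖ ^ 2 = ∑ t, ‖χ t‖ ^ 2 := by
  rw [EuclideanSpace.norm_sq_eq, Fintype.sum_prod_type, Fintype.sum_prod_type]
  simp [branches, EuclideanSpace.norm_sq_eq]

/-- The unitaries between queries: phase flips and walk operators, applied in the branches
`t` with `j < t`. -/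
noncomputable def stepUnitary
    (D : EuclideanSpace ℂ (ι × Option W) ≃ₗᵢ[ℂ] EuclideanSpace ℂ (ι × Option W)) (k : ℕ) :
    EuclideanSpace ℂ (Label N ι W) ≃ₗᵢ[ℂ] EuclideanSpace ℂ (Label N ι W) :=
  if k % 2 = 0 then signUnitary fun s => s.1.2 && (s.2.2.isSome && decide (k / 2 < s.1.1.1))
  else blockDiagonalUnitary fun κ => if k / 2 < κ.1.1 then D else LinearIsometryEquiv.refl ℂ _

/-- One query writes `x i` into the output bit, the sign flip reads it, and the next query erases
it. A phase query thus costs two queries and leaves the bit `false`. -/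
theorem two_steps (D : EuclideanSpace ℂ (ι × Option W) ≃ₗᵢ[ℂ] EuclideanSpace ℂ (ι × Option W))
    (x : ι → Bool) (χ : Fin N → EuclideanSpace ℂ (ι × Option W)) (j : ℕ) :
    stepUnitary D (2 * j + 1) (relabelledOracle (placement N ι W) x
      (stepUnitary D (2 * j) (relabelledOracle (placement N ι W) x (branches χ)))) =
    branches fun t => if j < t then D (phaseOracle x (χ t)) else χ t := by
  have h1 : relabelledOracle (placement N ι W) x
      (stepUnitary D (2 * j) (relabelledOracle (placement N ι W) x (branches χ))) =
      branches fun t => if j < t then phaseOracle x (χ t) else χ t := by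
    ext ⟨⟨t, b⟩, ⟨i, w⟩⟩
    have h2 : 2 * j % 2 = 0 := by lia
    have h3 : 2 * j / 2 = j := by lia
    simp only [stepUnitary, h2, h3, if_true, relabelledOracle_placement, signUnitary_apply]
    by_cases hj : j < t <;> cases b <;> cases hx : x i <;> cases w <;>
      simp [branches, phaseOracle, signUnitary_apply, hx, hj]
  rw [h1]
  have h2 : (2 * j + 1) % 2 = 1 := by lia
  have h3 : (2 * j + 1) / 2 = j := by lia
  ext ⟨⟨t, b⟩, y⟩
  simp only [stepUnitary, h2, h3, one_ne_zero, if_false, blockDiagonalUnitary_apply]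
  cases b
  · by_cases hj : j < t <;> simp [branches, hj]
  · have h0 : (WithLp.toLp 2 fun _ => 0 : EuclideanSpace ℂ (ι × Option W)) = 0 := rfl
    by_cases hj : j < t <;> simp [branches, hj, h0]

/-- Branch `t` is frozen after `t` rounds, hence the minimum. -/
theorem state_even (D : EuclideanSpace ℂ (ι × Option W) ≃ₗᵢ[ℂ] EuclideanSpace ℂ (ι × Option W))
    (x : ι → Bool) (ψ : EuclideanSpace ℂ (ι × Option W)) (j : ℕ) :
    relabelledState (placement N ι W) x (stepUnitary D) (branches fun _ => ψ) (2 * j) =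
      branches fun t => ((phaseOracle x).trans D)^[min t j] ψ := by
  induction j with
  | zero => simp [relabelledState]
  | succ j ih =>
    change stepUnitary D (2 * j + 1) (relabelledOracle _ x
      (stepUnitary D (2 * j) (relabelledOracle _ x (relabelledState _ x _ _ (2 * j))))) = _
    rw [ih, two_steps]
    congr 1
    funext t
    split_ifs with h
    · rw [min_eq_right h.le, min_eq_right h, Function.iterate_succ_apply']
      rfl
    · rw [min_eq_left (by lia), min_eq_left (by lia)]

/-- The walk with `2 * N` queries outputs `false` with probability the squared norm of the mean of
the first `N` points of the orbit. -/
theorem exists_outputProb_eq (hN : 0 < N)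
    (D : EuclideanSpace ℂ (ι × Option W) ≃ₗᵢ[ℂ] EuclideanSpace ℂ (ι × Option W))
    (ψ : EuclideanSpace ℂ (ι × Option W)) (hψ : ‖ψ‖ = 1) (i₀ : ι) :
    ∃ A : QuantumQueryAlgorithm ι (2 * N), ∀ x, A.outputProb x false =
      (‖∑ t ∈ Finset.range N, ((phaseOracle x).trans D)^[t] ψ‖ / N) ^ 2 := by
  obtain ⟨G, hG⟩ := exists_uniform_test N hN
  have hN' : (0 : ℝ) < N := by exact_mod_cast hN
  let a : ℂ := ((√N)⁻¹ : ℝ)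
  have ha : ‖a‖ ^ 2 = (N : ℝ)⁻¹ := by
    simp only [a, Complex.norm_real, norm_inv, inv_pow, Real.norm_eq_abs, sq_abs]
    rw [Real.sq_sqrt hN'.le]
  let τ := LinearIsometryEquiv.piLpCongrLeft 2 ℂ ℂ
    (Equiv.prodComm (Fin N × Bool) (ι × Option W))
  -- The test acts on the control register and output bit only; exchanging the factors makes it
  -- block diagonal.
  let V := (τ.trans (blockDiagonalUnitary fun _ => G)).trans τ.symm
  have hV : ∀ Ψ s y, V Ψ (s, y) = G (WithLp.toLp 2 fun s => Ψ (s, y)) s := fun _ _ _ => rfl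
  have hΨ₀ : ‖branches fun _ : Fin N => a • ψ‖ = 1 := by
    rw [← sq_eq_sq₀ (norm_nonneg _) zero_le_one, norm_sq_branches]
    simp only [norm_smul, mul_pow, ha, hψ]
    simp [hN'.ne']
  obtain ⟨A, hA⟩ := QuantumQueryAlgorithm.exists_of_relabelled (placement N ι W)
    ((⟨0, hN⟩, false), (i₀, none)) rfl (stepUnitary D) _ hΨ₀ V (2 * N)
  refine ⟨A, fun x => ?_⟩
  set u := (phaseOracle (W := W) x).trans D with hu
  have hua : ∀ t : ℕ, u^[t] (a • ψ) = a • u^[t] ψ := by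
    intro t
    induction t with
    | zero => rfl
    | succ t ih => simp only [Function.iterate_succ_apply', ih, map_smul]
  have hamp : ∀ t y, V (relabelledState (placement N ι W) x (stepUnitary D)
      (branches fun _ => a • ψ) (2 * N)) ((t, false), y) =
      ((N : ℂ)⁻¹ * a) * (∑ t ∈ Finset.range N, u^[t] ψ) y := by
    intro t y
    rw [hV, state_even, hG _ (fun t => by simp [branches])]
    simp only [branches, Bool.false_eq_true, if_false, ← hu]
    rw [mul_assoc, Finset.sum_range]
    simp only [WithLp.ofLp_sum, Finset.sum_apply, Finset.mul_sum]
    refine Finset.sum_congr rfl fun t _ => ?_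
    rw [min_eq_left t.2.le, hua]
    rfl
  rw [hA, Finset.sum_filter, Fintype.sum_prod_type, Fintype.sum_prod_type]
  simp only [Fintype.sum_bool]
  simp only [placement, Equiv.coe_fn_mk, Bool.true_eq_false, if_false, Finset.sum_const_zero,
    if_true, zero_add]
  simp only [placement] at hamp
  simp only [hamp, norm_mul, mul_pow, ← Finset.mul_sum, ha, ← EuclideanSpace.norm_sq_eq]
  simp
  field_simp

end WalkAlgorithm

/-! ### From witnesses to an algorithm -/

/-- A subspace `K` with positive and negative witnesses gives a quantum query algorithm. -/
theorem exists_computes_of_witnesses (f : (ι → Bool) → Bool) (i₀ : ι) {N : ℕ} (hN : 0 < N)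
    (K : Submodule ℂ (EuclideanSpace ℂ (ι × Option W)))
    (ψ : EuclideanSpace ℂ (ι × Option W)) (hψ : ‖ψ‖ = 1)
    (hfalse : ∀ x, f x = false → ∃ φ ∈ K, phaseOracle x φ = φ ∧ ‖φ - ψ‖ ≤ 1 / 20)
    (htrue : ∀ x, f x = true → ∃ w ∈ Kᗮ, w + phaseOracle x w = (2 : ℂ) • ψ ∧ 2 * ‖w‖ ≤ N) :
    ∃ A : QuantumQueryAlgorithm ι (2 * N), A.Computes f := by
  obtain ⟨A, hA⟩ := WalkAlgorithm.exists_outputProb_eq hN K.reflection ψ hψ i₀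
  have hN' : (0 : ℝ) < N := by exact_mod_cast hN
  refine ⟨A, fun x => ?_⟩
  set u := ((phaseOracle x).trans K.reflection).toLinearIsometry
  have hAx : A.outputProb x false = (‖∑ t ∈ Finset.range N, u^[t] ψ‖ / N) ^ 2 := hA x
  cases hx : f x
  · obtain ⟨φ, hφ, hR, hd⟩ := hfalse x hx
    have hfix : u φ = φ := by
      change K.reflection (phaseOracle x φ) = φ
      rw [hR, Submodule.reflection_mem_subspace_eq_self hφ]
    have h1 := le_norm_sum_iterate u (ψ := ψ) hfix N
    rw [hψ] at h1
    -- `9 / 10 = 1 - 2 / 20`, and its square exceeds `2 / 3`.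
    have h2 : (9 / 10 : ℝ) ≤ ‖∑ t ∈ Finset.range N, u^[t] ψ‖ / N := by
      rw [le_div_iff₀ hN']
      nlinarith
    rw [hAx]
    nlinarith
  · obtain ⟨w, hw, hR, hd⟩ := htrue x hx
    -- The phase oracle is an involution and the reflection negates `w`, so `u` sends `phaseOracle x
    -- w` to `-w`.
    have hcob : ψ = (1 / 2 : ℂ) • phaseOracle x w - u ((1 / 2 : ℂ) • phaseOracle x w) := by
      have h1 : u (phaseOracle x w) = -w := by
        change K.reflection (phaseOracle x (phaseOracle x w)) = -w
        rw [phaseOracle, signUnitary_signUnitary,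
          Submodule.reflection_mem_subspace_orthogonalComplement_eq_neg hw]
      rw [map_smul, h1, smul_neg, sub_neg_eq_add, ← smul_add, add_comm, hR, smul_smul]
      norm_num
    have h1 := norm_sum_iterate_le u hcob N
    rw [norm_smul, (phaseOracle x).norm_map] at h1
    norm_num at h1
    have h2 : ‖∑ t ∈ Finset.range N, u^[t] ψ‖ / N ≤ 1 / 2 := by
      rw [div_le_iff₀ hN']
      linarith
    have h3 := A.outputProb_add x
    have h4 : 0 ≤ ‖∑ t ∈ Finset.range N, u^[t] ψ‖ / N := by positivity
    rw [hAx] at h3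
    nlinarith

/-! ### Unit flows along paths -/

section PathFlow

variable {V : Type*}

/-- The telescoping sum along a walk. -/
theorem sum_darts_sub {G : SimpleGraph V} {s u : V} (p : G.Walk s u) (g : V → ℂ) :
    ((p.darts.map SimpleGraph.Dart.toProd).map fun d => g d.1 - g d.2).sum = g s - g u := by
  induction p with
  | nil => simp
  | cons h p ih => simp only [SimpleGraph.Walk.darts_cons, List.map_cons, List.sum_cons, ih]; ring

/-- In a connected graph there is a unit flow between any two vertices, supported on fewer darts
than there are vertices. -/
theorem exists_unit_flow [Fintype V] [DecidableEq V] {G : SimpleGraph V} (hG : G.Connected)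
    (s u : V) : ∃ F : Finset (V × V), (∀ d ∈ F, G.Adj d.1 d.2) ∧ F.card ≤ Fintype.card V ∧
      ∀ g : V → ℂ, ∑ d ∈ F, (g d.1 - g d.2) = g s - g u := by
  obtain ⟨p, hp⟩ := hG.exists_isPath s u
  have hnd : (p.darts.map SimpleGraph.Dart.toProd).Nodup :=
    (SimpleGraph.Walk.darts_nodup_of_support_nodup hp.support_nodup).map
      fun a b h => SimpleGraph.Dart.ext a b h
  refine ⟨(p.darts.map SimpleGraph.Dart.toProd).toFinset, ?_, ?_, ?_⟩
  · intro d hd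
    rw [List.mem_toFinset, List.mem_map] at hd
    obtain ⟨a, -, rfl⟩ := hd
    exact a.adj
  · rw [List.toFinset_card_of_nodup hnd, List.length_map, SimpleGraph.Walk.length_darts]
    exact hp.length_lt.le
  · intro g
    rw [List.sum_toFinset _ hnd, sum_darts_sub]

end PathFlow

/-! ### The span program for connectivity -/

namespace ConnectivitySpan

variable {n : ℕ}

theorem sum_vertexPair_ite {M : Type*} [AddCommMonoid M] {a b : Fin n} (hab : a ≠ b) (c : M) :
    ∑ e : VertexPair n, (if e.1 = s(a, b) then c else 0) = c := by
  have h : ∀ e : VertexPair n, e.1 = s(a, b) ↔ e = ⟨s(a, b), by simpa using hab⟩ := fun e =>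
    ⟨fun h => Subtype.ext h, fun h => congrArg Subtype.val h⟩
  simp only [h, Finset.sum_ite_eq', Finset.mem_univ, if_true]

/-- The amplitudes of a vector: `c` at `(e₀, none)` and `h u a b` at `(ab, some (u, a, b))`. -/
noncomputable def edgeVector (e₀ : VertexPair n) (c : ℂ) (h : Fin n → Fin n × Fin n → ℂ) :
    EuclideanSpace ℂ (VertexPair n × Option (Fin n × Fin n × Fin n)) :=
  WithLp.toLp 2 fun s => s.2.elim (if s.1 = e₀ then c else 0)
    fun y => if s.1.1 = s(y.2.1, y.2.2) then h y.1 y.2 else 0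

/-- Diagonal pairs label no query index, so their terms must vanish; this is the role of `hh`. -/
theorem inner_edgeVector (e₀ : VertexPair n) (c c' : ℂ) (h h' : Fin n → Fin n × Fin n → ℂ)
    (hh : ∀ u a, h u (a, a) = 0) :
    inner ℂ (edgeVector e₀ c h) (edgeVector e₀ c' h') =
      inner ℂ c c' + ∑ u, ∑ d, inner ℂ (h u d) (h' u d) := by
  rw [PiLp.inner_apply, Fintype.sum_prod_type_right, Fintype.sum_option]
  congr 1
  · have h1 : ∀ e : VertexPair n, inner ℂ (edgeVector e₀ c h (e, none))
        (edgeVector e₀ c' h' (e, none)) = if e = e₀ then inner ℂ c c' else 0 := by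
      intro e
      by_cases he : e = e₀ <;> simp [edgeVector, he]
    simp only [h1, Finset.sum_ite_eq', Finset.mem_univ, if_true]
  · rw [Fintype.sum_prod_type]
    refine Finset.sum_congr rfl fun u _ => Finset.sum_congr rfl fun d _ => ?_
    have h1 : ∀ e : VertexPair n, inner ℂ (edgeVector e₀ c h (e, some (u, d)))
        (edgeVector e₀ c' h' (e, some (u, d))) =
        if e.1 = s(d.1, d.2) then inner ℂ (h u d) (h' u d) else 0 := by
      intro e
      by_cases he : e.1 = s(d.1, d.2) <;> simp [edgeVector, he]
    simp only [h1]
    by_cases hd : d.1 = d.2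
    · have h0 : h u d = 0 := by rw [← hh u d.1]; congr 1; ext <;> simp [hd]
      simp [h0]
    · exact sum_vertexPair_ite hd _

theorem norm_sq_edgeVector (e₀ : VertexPair n) (c : ℂ) (h : Fin n → Fin n × Fin n → ℂ)
    (hh : ∀ u a, h u (a, a) = 0) :
    ‖edgeVector e₀ c h‖ ^ 2 = ‖c‖ ^ 2 + ∑ u, ∑ d, ‖h u d‖ ^ 2 := by
  have h1 := inner_edgeVector e₀ c c h h hh
  simp only [inner_self_eq_norm_sq_to_K] at h1
  exact_mod_cast h1

theorem edgeVector_sub (e₀ : VertexPair n) (c c' : ℂ) (h h' : Fin n → Fin n × Fin n → ℂ) :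
    edgeVector e₀ c h - edgeVector e₀ c' h' = edgeVector e₀ (c - c') (h - h') := by
  ext ⟨e, y⟩
  cases y with
  | none => by_cases he : e = e₀ <;> simp [edgeVector, he]
  | some y => by_cases he : e.1 = s(y.2.1, y.2.2) <;> simp [edgeVector, he]

/-- The potential differences along edges. -/
def gradient (g : Fin n → Fin n → ℂ) (u : Fin n) (d : Fin n × Fin n) : ℂ := g u d.1 - g u d.2

/-- The span program: the potential `g u` is for the flow from `s` to `u`. -/
noncomputable def gradientMap (e₀ : VertexPair n) (s : Fin n) (α : ℝ) :
    (Fin n → Fin n → ℂ) →ₗ[ℂ]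
      EuclideanSpace ℂ (VertexPair n × Option (Fin n × Fin n × Fin n)) where
  toFun g := edgeVector e₀ (α * ∑ u, (g u s - g u u)) (gradient g)
  map_add' g g' := by
    ext ⟨e, y⟩
    cases y with
    | none =>
      by_cases he : e = e₀ <;> simp [edgeVector, he, Finset.sum_add_distrib]
      ring
    | some y =>
      by_cases he : e.1 = s(y.2.1, y.2.2) <;> simp [edgeVector, he, gradient]
      ring
  map_smul' a g := by
    ext ⟨e, y⟩
    cases y with
    | none =>
      by_cases he : e = e₀ <;> simp [edgeVector, he, ← Finset.mul_sum, ← mul_sub]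
      ring
    | some y =>
      by_cases he : e.1 = s(y.2.1, y.2.2) <;> simp [edgeVector, he, gradient]
      ring

theorem gradientMap_apply (e₀ : VertexPair n) (s : Fin n) (α : ℝ) (g : Fin n → Fin n → ℂ) :
    gradientMap e₀ s α g = edgeVector e₀ (α * ∑ u, (g u s - g u u)) (gradient g) :=
  rfl

theorem phaseOracle_edgeVector (x : VertexPair n → Bool) [DecidableRel (inputGraph x).Adj]
    (e₀ : VertexPair n) (c : ℂ) (h : Fin n → Fin n × Fin n → ℂ) :
    phaseOracle x (edgeVector e₀ c h) = edgeVector e₀ c fun u d =>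
      (if (inputGraph x).Adj d.1 d.2 then -1 else 1) * h u d := by
  ext ⟨e, y⟩
  cases y with
  | none => simp [phaseOracle, signUnitary_apply, edgeVector]
  | some y =>
    obtain ⟨e, hd⟩ := e
    by_cases he : e = s(y.2.1, y.2.2)
    · subst he
      have hA : (inputGraph x).Adj y.2.1 y.2.2 ↔ x ⟨s(y.2.1, y.2.2), hd⟩ = true :=
        ⟨fun h => h.2, fun h => ⟨hd, h⟩⟩
      simp only [phaseOracle, signUnitary_apply, edgeVector, Option.elim, if_true,
        Option.isSome_some, Bool.and_true, hA]
    · simp [phaseOracle, signUnitary_apply, edgeVector, he]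

/-- Connected graphs have flow witnesses. -/
theorem exists_flow_witness (e₀ : VertexPair n) (s : Fin n) (α : ℝ) (x : VertexPair n → Bool)
    (hx : (inputGraph x).Connected) :
    ∃ w ∈ (LinearMap.range (gradientMap e₀ s α))ᗮ,
      w + phaseOracle x w = (2 : ℂ) • edgeVector e₀ 1 0 ∧ ‖w‖ ^ 2 ≤ 1 + α ^ 2 * n ^ 2 := by
  classical
  choose F hadj hcard hflow using exists_unit_flow hx s
  have hdiag : ∀ u a, (a, a) ∉ F u := fun u a h => (hadj u _ h).ne rfl
  -- The weight `-α` cancels the target coordinate against the flow identity. The flow lives on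
  -- edges, where the phase oracle changes its sign, so only the target survives in the sum.
  refine ⟨edgeVector e₀ 1 fun u d => if d ∈ F u then -(α : ℂ) else 0, ?_, ?_, ?_⟩
  · rw [Submodule.mem_orthogonal]
    rintro _ ⟨g, rfl⟩
    rw [gradientMap_apply, inner_edgeVector _ _ _ _ _ (by simp [gradient])]
    have h1 : ∀ u, ∑ d, inner ℂ (gradient g u d) (if d ∈ F u then -(α : ℂ) else 0) =
        -(α : ℂ) * starRingEnd ℂ (g u s - g u u) := by
      intro u
      have h2 : ∀ d, inner ℂ (gradient g u d) (if d ∈ F u then -(α : ℂ) else 0) =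
          if d ∈ F u then -(α : ℂ) * starRingEnd ℂ (g u d.1 - g u d.2) else 0 := by
        intro d
        split_ifs
        · rfl
        · simp
      rw [← hflow u (g u), map_sum, Finset.mul_sum]
      simp only [h2, Finset.sum_ite_mem, Finset.univ_inter]
    simp only [h1, ← Finset.mul_sum, ← map_sum]
    simp
  · rw [phaseOracle_edgeVector]
    ext ⟨e, y⟩
    cases y with
    | none => by_cases he : e = e₀ <;> simp [edgeVector, he]; norm_num
    | some y =>
      by_cases hy : y.2 ∈ F y.1
      · have := hadj _ _ hy
        by_cases he : e.1 = s(y.2.1, y.2.2) <;> simp [edgeVector, he, hy, this]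
      · simp [edgeVector, hy]
  · rw [norm_sq_edgeVector _ _ _ (by simp [hdiag])]
    have h1 : ∀ u, ∑ d, ‖if d ∈ F u then -(α : ℂ) else 0‖ ^ 2 ≤ α ^ 2 * n := by
      intro u
      have h2 : ∀ d, ‖if d ∈ F u then -(α : ℂ) else 0‖ ^ 2 = if d ∈ F u then α ^ 2 else 0 := by
        intro d
        split_ifs <;> simp
      simp only [h2, Finset.sum_ite_mem, Finset.univ_inter, Finset.sum_const, nsmul_eq_mul]
      have h3 : ((F u).card : ℝ) ≤ n := by exact_mod_cast (hcard u).trans_eq (Fintype.card_fin n)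
      rw [mul_comm]
      gcongr
    have h4 := Finset.sum_le_sum fun u (_ : u ∈ Finset.univ) => h1 u
    simp only [Finset.sum_const, Finset.card_univ, Fintype.card_fin, nsmul_eq_mul] at h4
    rw [norm_one]
    nlinarith

/-- Disconnected graphs have cut witnesses. -/
theorem exists_cut_witness (e₀ : VertexPair n) (s : Fin n) {α : ℝ} (hα : 0 < α)
    (x : VertexPair n → Bool) (hx : ¬ (inputGraph x).Connected) :
    ∃ φ ∈ LinearMap.range (gradientMap e₀ s α), phaseOracle x φ = φ ∧
      ‖φ - edgeVector e₀ 1 0‖ ^ 2 ≤ 2 * n / α ^ 2 := by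
  classical
  set S : Finset (Fin n) := {v | (inputGraph x).Reachable s v} with hS
  have hsS : s ∈ S := by simp [hS]
  have hadj : ∀ a b, (inputGraph x).Adj a b → (a ∈ S ↔ b ∈ S) := by
    intro a b hab
    simp only [hS, Finset.mem_filter_univ]
    exact ⟨fun h => h.trans hab.reachable, fun h => h.trans hab.symm.reachable⟩
  have hne : Sᶜ.Nonempty := by
    by_contra h0
    rw [Finset.not_nonempty_iff_eq_empty, Finset.compl_eq_empty_iff] at h0
    have hr : ∀ v, (inputGraph x).Reachable s v := fun v => by
      have : v ∈ S := h0 ▸ Finset.mem_univ v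
      simpa [hS] using this
    have : Nonempty (Fin n) := ⟨s⟩
    exact hx ⟨fun u v => (hr u).symm.trans (hr v)⟩
  set m : ℝ := (Sᶜ.card : ℝ) with hm
  have hm0 : 0 < m := Nat.cast_pos.mpr hne.card_pos
  -- Each of the `m` vertices cut off from `s` contributes `c`; this value makes the target
  -- coordinate 1.
  let c : ℂ := ((α * m)⁻¹ : ℝ)
  let g : Fin n → Fin n → ℂ := fun u v => if u ∈ S then 0 else if v ∈ S then c else 0
  have hsum : ∑ u, (g u s - g u u) = m * c := by
    have h1 : ∀ u, g u s - g u u = if u ∈ Sᶜ then c else 0 := by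
      intro u
      by_cases hu : u ∈ S <;> simp [g, hu, hsS]
    simp only [h1, Finset.sum_ite_mem, Finset.univ_inter, Finset.sum_const, nsmul_eq_mul]
    simp [hm]
  have hval : gradientMap e₀ s α g = edgeVector e₀ 1 (gradient g) := by
    rw [gradientMap_apply, hsum]
    congr 1
    have h1 : α * (m * (α * m)⁻¹) = 1 := by field_simp
    change (α : ℂ) * (m * (((α * m)⁻¹ : ℝ) : ℂ)) = 1
    exact_mod_cast h1
  refine ⟨_, ⟨g, rfl⟩, ?_, ?_⟩
  · rw [hval, phaseOracle_edgeVector]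
    congr 1
    funext u d
    split_ifs with h
    · simp [gradient, g, hadj _ _ h]
    · simp
  · rw [hval, edgeVector_sub, norm_sq_edgeVector _ _ _ (by simp [gradient])]
    have hc : ‖c‖ ^ 2 = (α * m)⁻¹ ^ 2 := by
      simp only [c, Complex.norm_real, Real.norm_eq_abs, sq_abs]
    -- A pair across the cut has an endpoint outside `S`. Counting such endpoints gives `2 * n * m`
    -- for each of the `m` relevant `u`, and `m ^ 2` cancels against `c`.
    have h1 : ∀ u d, ‖(gradient g - 0) u d‖ ^ 2 ≤
        (if u ∈ Sᶜ then 1 else 0) * ((α * m)⁻¹ ^ 2 * ((if d.2 ∈ Sᶜ then 1 else 0) +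
          (if d.1 ∈ Sᶜ then 1 else 0))) := by
      intro u d
      by_cases hu : u ∈ S <;> by_cases h1 : d.1 ∈ S <;> by_cases h2 : d.2 ∈ S <;>
        simp only [sub_zero, gradient, g, hu, h1, h2, if_true, if_false, Finset.mem_compl,
          not_true, not_false_iff, sub_self, zero_sub, norm_neg, norm_zero, hc] <;>
        first | (norm_num; done) | (norm_num; positivity)
    have h2 : ∀ u, ∑ d, ‖(gradient g - 0) u d‖ ^ 2 ≤
        (if u ∈ Sᶜ then 1 else 0) * ((α * m)⁻¹ ^ 2 * (2 * n * m)) := by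
      intro u
      refine (Finset.sum_le_sum fun d _ => h1 u d).trans_eq ?_
      rw [← Finset.mul_sum, ← Finset.mul_sum, Finset.sum_add_distrib, Fintype.sum_prod_type,
        Fintype.sum_prod_type]
      simp only [Finset.sum_ite_mem, Finset.univ_inter, Finset.sum_const, nsmul_eq_mul, mul_one,
        Finset.card_univ, Fintype.card_fin, ← hm]
      rw [Finset.sum_comm]
      simp only [Finset.sum_ite_mem, Finset.univ_inter, Finset.sum_const, nsmul_eq_mul, mul_one,
        Finset.card_univ, Fintype.card_fin, ← hm]
      ring
    have h3 := Finset.sum_le_sum fun u (_ : u ∈ Finset.univ) => h2 u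
    rw [← Finset.sum_mul] at h3
    simp only [Finset.sum_ite_mem, Finset.univ_inter, Finset.sum_const, nsmul_eq_mul, mul_one,
      ← hm] at h3
    rw [sub_self, norm_zero]
    refine (add_le_add_right h3 _).trans_eq ?_
    field_simp
    ring

end ConnectivitySpan

/-! ### Choice of parameters -/

/-- There are algorithms for connectivity with `O(n ^ (3 / 2))` queries. -/
theorem exists_computes_connectivity {n : ℕ} (hn : 2 ≤ n) {N : ℕ}
    (hN : 4 * (1 + 800 * (n : ℝ) ^ 3) ≤ (N : ℝ) ^ 2) :
    ∃ A : QuantumQueryAlgorithm (VertexPair n) (2 * N), A.Computes (connectivity n) := by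
  have hn0 : (0 : ℝ) < n := by exact_mod_cast (by lia : 0 < n)
  let s : Fin n := ⟨0, by lia⟩
  let e₀ : VertexPair n := ⟨s(s, ⟨1, by lia⟩), by simp [s]⟩
  -- With `α ^ 2 = 800 * n` the cut error `2 * n / α ^ 2` is exactly `(1 / 20) ^ 2`.
  have hα : (0 : ℝ) < √(800 * n) := Real.sqrt_pos.mpr (by positivity)
  have hα2 : √(800 * n) ^ 2 = 800 * n := Real.sq_sqrt (by positivity)
  have hN0 : 0 < N := by
    rcases Nat.eq_zero_or_pos N with rfl | h
    · have : (0 : ℝ) < n ^ 3 := by positivity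
      norm_num at hN
      linarith
    · exact h
  refine exists_computes_of_witnesses (connectivity n) e₀ hN0
    (LinearMap.range (ConnectivitySpan.gradientMap e₀ s √(800 * n)))
    (ConnectivitySpan.edgeVector e₀ 1 0) ?_ ?_ ?_
  · have h := ConnectivitySpan.norm_sq_edgeVector e₀ 1 0 (by simp)
    rw [← sq_eq_sq₀ (norm_nonneg _) zero_le_one, h]
    simp
  · intro x hx
    have hx' : ¬ (inputGraph x).Connected := by simpa [connectivity] using hx
    obtain ⟨φ, hφ, hR, hd⟩ := ConnectivitySpan.exists_cut_witness e₀ s hα x hx'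
    refine ⟨φ, hφ, hR, ?_⟩
    rw [← sq_le_sq₀ (norm_nonneg _) (by norm_num)]
    refine hd.trans_eq ?_
    rw [hα2]
    field_simp
    norm_num
  · intro x hx
    have hx' : (inputGraph x).Connected := by simpa [connectivity] using hx
    obtain ⟨w, hw, hR, hd⟩ := ConnectivitySpan.exists_flow_witness e₀ s √(800 * n) x hx'
    refine ⟨w, hw, hR, ?_⟩
    rw [← sq_le_sq₀ (by positivity) (by positivity)]
    rw [hα2] at hd
    nlinarith

theorem mainTheorem8 :
    ∃ C : ℝ, ∀ n : ℕ, 2 ≤ n →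
      (∃ A : QuantumQueryAlgorithm (VertexPair n) (quantumQueryComplexity (connectivity n)),
        A.Computes (connectivity n)) ∧
      (quantumQueryComplexity (connectivity n) : ℝ) ≤ C * (n : ℝ) ^ (3 / 2 : ℝ) := by
  refine ⟨120, fun n hn => ?_⟩
  have hn1 : (1 : ℝ) ≤ n := by exact_mod_cast (by lia : 1 ≤ n)
  set r : ℝ := (n : ℝ) ^ (3 / 2 : ℝ) with hr
  have hr1 : 1 ≤ r := Real.one_le_rpow hn1 (by norm_num)
  have hr2 : r ^ 2 = (n : ℝ) ^ 3 := by
    rw [hr, ← Real.rpow_natCast, ← Real.rpow_mul (by linarith), ← Real.rpow_natCast]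
    norm_num
  have hle := Nat.le_ceil (58 * r)
  have hlt := Nat.ceil_lt_add_one (a := 58 * r) (by linarith)
  -- As `1 ≤ r`, the left side is at most `3204 * r ^ 2`, and `58 ^ 2 = 3364`.
  have hN : 4 * (1 + 800 * (n : ℝ) ^ 3) ≤ (⌈58 * r⌉₊ : ℝ) ^ 2 := by
    rw [← hr2]
    nlinarith
  have hmem := exists_computes_connectivity hn hN
  have hinf : quantumQueryComplexity (connectivity n) ≤ 2 * ⌈58 * r⌉₊ := Nat.sInf_le hmem
  -- Attainment needs a nonempty set, since `sInf ∅ = 0` in `ℕ`.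
  refine ⟨Nat.sInf_mem
    (s := {T : ℕ | ∃ A : QuantumQueryAlgorithm (VertexPair n) T, A.Computes (connectivity n)})
    ⟨_, hmem⟩, ?_⟩
  have hinf' : (quantumQueryComplexity (connectivity n) : ℝ) ≤ 2 * ⌈58 * r⌉₊ := by
    exact_mod_cast hinf
  linarith
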